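/- **Definitions.** Circles on the Riemann sphere $\hat{\mathbb C}=\mathbb C\cup\{\infty\}$ include straight lines (with $\infty$). An oriented circle is a circle with a choice of one of the two open caps it bounds as its interior. Its signed curvature $b$ is $1/r$ if it is a Euclidean circle of radius $r$ whose interior is the bounded disk, $-1/r$ if its interior is the unbounded side, and $0$ if it is a line. Its augmented curvature-center coordinates are the row vector $(\bar b, b, w_1, w_2)$, where $\bar b$ is the signed curvature of its image under inversion in the unit circle, and $(w_1,w_2)$ is $b$ times the center, or, for a line, the unit normal vector pointing into its interior. An (ordered, oriented) Descartes configuration $\mathcal D$ consists of four pairwise tangent oriented circles $C_1,\dots,C_4$ (parallel lines are tangent at $\infty$), no three through a common point, whose interiors are pairwise disjoint, or become so after reversing all four orientations. Let $W_{\mathcal D}$ be the $4\times4$ matrix whose $i$-th row is the coordinate vector of $C_i$. For $1\le i\le 4$ let $S_i$ be the $4\times 4$ identity matrix with its $i$-th row replaced by the row with $-1$ in position $i$ and $2$ in the other positions, and let $S_i^\perp=S_i^T$. The super-Apollonian group $\mathcal A^S\subset GL(4,\mathbb Z)$ is the group generated by $S_1,\dots,S_4,S_1^\perp,\dots,S_4^\perp$.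 An Apollonian super-packing is an orbit $\mathcal A^S[\mathcal D]$, i.e. the set of all Descartes configurations $\mathcal D'$ with $W_{\mathcal D'}=UW_{\mathcal D}$ for some $U\in\mathcal A^S$. The associated geometric super-packing consists of all the (unoriented) circles of these configurations, as a point set on $\hat{\mathbb C}$. A Descartes configuration is integral if its four curvatures are integers, and its divisor is then their greatest common divisor. A super-packing is integral if it contains an integral Descartes configuration; its divisor is the divisor of any Descartes configuration in it. A Euclidean motion is an isometry of the plane (reflections included), extended to $\hat{\mathbb C}$ by $\infty\mapsto\infty$. **Theorem.** Let $g\ge1$ be an integer. 1. The divisor is well defined: if one Descartes configuration in an Apollonian super-packing is integral with divisor $g$, then so are all of them. 2. There is an integral Apollonian super-packing with divisor $g$. 3. The associated geometric super-packing is unique up to a Euclidean motion: for any two integral Apollonian super-packings with divisor $g$ there is a Euclidean motion that takes the geometric super-packing of the first onto that of the second, as point sets on $\hat{\mathbb C}$, and that also takes the set of circles of the first onto that of the second, and the set of unordered, unoriented Descartes configurations of the first onto that of the second. 4. Hence every integral Apollonian super-packing with divisor $g$ contains a copy of every integral Descartes configuration with divisor $g$: some Euclidean motion takes the configuration (as an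 unordered, unoriented set of four circles) to the set of four circles of a Descartes configuration of the super-packing. -/

import Mathlib

namespace Apollonian

/-- The Riemann sphere `ℂ ∪ {∞}`. -/
abbrev RiemannSphere : Type := OnePoint ℂ

/-- An oriented circle on the Riemann sphere.
* `circle c ρ _` is the Euclidean circle with center `c` and radius `|ρ|`; the sign of `ρ` is the
  orientation: the interior is the open disk if `ρ > 0`, and the outside (with `∞`) if `ρ < 0`.
* `line h m _` is the straight line `{z : ⟨z, h⟩ = m}` together with `∞`, where `h` is a unit normal
  vector; the orientation is given by `h`: the interior is the half plane `{z : ⟨z, h⟩ > m}`.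
Every oriented circle has exactly one such description. -/
inductive OrientedCircle : Type
  | circle (c : ℂ) (ρ : ℝ) (hρ : ρ ≠ 0) : OrientedCircle
  | line (h : ℂ) (m : ℝ) (hh : ‖h‖ = 1) : OrientedCircle

namespace OrientedCircle

/-- The underlying unoriented circle, a subset of the Riemann sphere. -/
def points : OrientedCircle → Set RiemannSphere
  | circle c ρ _ => (fun z : ℂ => (z : RiemannSphere)) '' {z | ‖z - c‖ = |ρ|}
  | line h m _ => insert OnePoint.infty
      ((fun z : ℂ => (z : RiemannSphere)) '' {z | z.re * h.re + z.im * h.im = m})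

open Classical in
/-- The interior, one of the two open caps bounded by the circle on the Riemann sphere. -/
noncomputable def interior : OrientedCircle → Set RiemannSphere
  | circle c ρ _ =>
      if 0 < ρ then (fun z : ℂ => (z : RiemannSphere)) '' {z | ‖z - c‖ < ρ}
      else insert OnePoint.infty
        ((fun z : ℂ => (z : RiemannSphere)) '' {z | -ρ < ‖z - c‖})
  | line h m _ => (fun z : ℂ => (z : RiemannSphere)) '' {z | m < z.re * h.re + z.im * h.im}

/-- The same circle with the opposite orientation. -/
def reverse : OrientedCircle → OrientedCircle
  | circle c ρ hρ => circle c (-ρ) (neg_ne_zero.mpr hρ)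
  | line h m hh => line (-h) (-m) (by rw [norm_neg]; exact hh)

/-- The signed curvature; it is `0` for a straight line. -/
noncomputable def curvature : OrientedCircle → ℝ
  | circle _ ρ _ => 1 / ρ
  | line _ _ _ => 0

/-- The augmented curvature-center coordinates `(b̄, b, w₁, w₂)`: here `b` is the signed curvature,
`b̄` is the signed curvature of the image of the oriented circle under inversion in the unit
circle, and `(w₁, w₂)` is curvature times center (for a line, the unit normal vector). -/
noncomputable def coords : OrientedCircle → Fin 4 → ℝ
  | circle c ρ _ => ![‖c‖ ^ 2 / ρ - ρ, 1 / ρ, c.re / ρ, c.im / ρ]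
  | line h m _ => ![2 * m, 0, h.re, h.im]

end OrientedCircle

/-- An ordered, oriented Descartes configuration: four mutually tangent circles on the Riemann
sphere (distinct circles are tangent when they meet in exactly one point; parallel lines are
tangent at `∞`), no three of them through a common point, with orientations such that the four
interiors are pairwise disjoint (total orientation positive) or become so when all four
orientations are reversed (total orientation negative). -/
structure DescartesConfiguration : Type where
  circles : Fin 4 → OrientedCircle
  tangent : ∀ i j, i ≠ j → ∃ p, (circles i).points ∩ (circles j).points = {p}
  no_triple : ∀ i j k, i ≠ j → j ≠ k → i ≠ k →
    (circles i).points ∩ (circles j).points ∩ (circles k).points = ∅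
  oriented :
    (∀ i j, i ≠ j → Disjoint (circles i).interior (circles j).interior) ∨
    (∀ i j, i ≠ j → Disjoint (circles i).reverse.interior (circles j).reverse.interior)

namespace DescartesConfiguration

/-- The `4 × 4` matrix `W_D` of augmented curvature-center coordinates, one row per circle. -/
noncomputable def W (D : DescartesConfiguration) : Matrix (Fin 4) (Fin 4) ℝ :=
  Matrix.of fun i => (D.circles i).coords

/-- All four circles have integer curvatures. -/
def IsIntegral (D : DescartesConfiguration) : Prop :=
  ∀ i, ∃ n : ℤ, (D.circles i).curvature = n

/-- `D` is integral and the greatest common divisor of its four curvatures is `g`. -/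
def HasDivisor (D : DescartesConfiguration) (g : ℕ) : Prop :=
  ∃ b : Fin 4 → ℤ, (∀ i, (D.circles i).curvature = b i) ∧ Finset.univ.gcd b = (g : ℤ)

/-- The underlying unordered, unoriented Descartes configuration: a set of four circles. -/
def unordered (D : DescartesConfiguration) : Set (Set RiemannSphere) :=
  Set.range fun i => (D.circles i).points

end DescartesConfiguration

/-- The matrix `S_i`: the identity matrix with row `i` replaced by the row that has `-1` in
position `i` and `2` in the other three positions. -/
def SMatrix (i : Fin 4) : Matrix (Fin 4) (Fin 4) ℤ :=
  Matrix.of fun j k =>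
    if j = i then (if k = i then -1 else 2) else (if j = k then 1 else 0)

theorem SMatrix_mul_self (i : Fin 4) : SMatrix i * SMatrix i = 1 := by
  revert i; decide

theorem SMatrix_transpose_mul_self (i : Fin 4) :
    (SMatrix i).transpose * (SMatrix i).transpose = 1 := by
  rw [← Matrix.transpose_mul, SMatrix_mul_self, Matrix.transpose_one]

/-- The generator `S_i` of the Apollonian group, as an element of `GL(4, ℤ)`. -/
def S (i : Fin 4) : Matrix.GeneralLinearGroup (Fin 4) ℤ :=
  ⟨SMatrix i, SMatrix i, SMatrix_mul_self i, SMatrix_mul_self i⟩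

/-- The generator `S_i^⊥ = S_iᵀ` of the dual Apollonian group, as an element of `GL(4, ℤ)`. -/
def SPerp (i : Fin 4) : Matrix.GeneralLinearGroup (Fin 4) ℤ :=
  ⟨(SMatrix i).transpose, (SMatrix i).transpose,
    SMatrix_transpose_mul_self i, SMatrix_transpose_mul_self i⟩

/-- The super-Apollonian group, generated by `S₁, …, S₄, S₁^⊥, …, S₄^⊥`. -/
def superApollonianGroup : Subgroup (Matrix.GeneralLinearGroup (Fin 4) ℤ) :=
  Subgroup.closure (Set.range S ∪ Set.range SPerp)

/-- The orbit of `D` under the super-Apollonian group, which acts on Descartes configurations by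
left multiplication on their augmented curvature-center coordinate matrices. -/
def superOrbit (D : DescartesConfiguration) : Set DescartesConfiguration :=
  {D' | ∃ U ∈ superApollonianGroup,
    D'.W = ((U : Matrix (Fin 4) (Fin 4) ℤ).map (fun n : ℤ => (n : ℝ))) * D.W}

/-- An (algebraic) Apollonian super-packing: the orbit of a Descartes configuration. -/
def IsSuperPacking (P : Set DescartesConfiguration) : Prop :=
  ∃ D, P = superOrbit D

/-- A super-packing is integral if it contains a configuration with integer curvatures. -/
def IsIntegralPacking (P : Set DescartesConfiguration) : Prop :=
  ∃ D ∈ P, D.IsIntegral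

/-- `g` is the divisor of `P`: the gcd of the (integer) curvatures in any configuration of `P`. -/
def PackingHasDivisor (P : Set DescartesConfiguration) (g : ℕ) : Prop :=
  ∀ D ∈ P, D.HasDivisor g

/-- The unordered, unoriented Descartes configurations of the associated geometric
super-packing. -/
def geometricConfigurations (P : Set DescartesConfiguration) :
    Set (Set (Set RiemannSphere)) :=
  {K | ∃ D ∈ P, K = D.unordered}

/-- The circles of the associated geometric super-packing. -/
def geometricCircles (P : Set DescartesConfiguration) : Set (Set RiemannSphere) :=
  {C | ∃ D ∈ P, C ∈ D.unordered}

/-- The associated geometric super-packing as a point set on the Riemann sphere: the union of all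
its circles. -/
def geometricPointSet (P : Set DescartesConfiguration) : Set RiemannSphere :=
  {x | ∃ C ∈ geometricCircles P, x ∈ C}

/-- A Euclidean motion of the plane (translation, rotation, reflection, glide reflection), extended
to the Riemann sphere by `∞ ↦ ∞`. -/
noncomputable def motion (φ : ℂ ≃ᵢ ℂ) : RiemannSphere → RiemannSphere :=
  OnePoint.map φ

/-- The image of a set of circles under a Euclidean motion. -/
noncomputable def motionCircles (φ : ℂ ≃ᵢ ℂ) (K : Set (Set RiemannSphere)) : Set (Set RiemannSphere) :=
  (fun C => motion φ '' C) '' K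

end Apollonian

namespace Apollonian

/-! Oriented circles are the vectors of norm 1 for a form of signature (3,1), and a Descartes
configuration is the same thing as four vectors with Gram matrix `gramMatrix`, i.e. 1 on the
diagonal and -1 off it (`DescartesConfiguration.isDescartesFrame`,
`IsDescartesFrame.exists_configuration`). The super-Apollonian group preserves this Gram matrix, so
it acts on configurations. It acts on curvature vectors by invertible integer matrices, hence
preserves their gcd (`gcd_mulVec`).

The heart is a descent (`exists_reduction`): while some curvature is negative, or exceeds half of
the positive sum, a suitable `SPerp i` or `S i` lowers the sum and keeps it positive. The descent
ends at a permutation of (0,0,m,m), and the gcd forces m = g. Any configuration with curvatures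
(0,0,g,g) is congruent to one fixed strip (`IsDescartesFrame.exists_motionCoords`).

Motions act linearly on rows, so they commute with the group, as does a global sign. Permutations of
the rows normalize the group. So the congruence with the strip extends to whole orbits
(`image_geometricConfigurations`). -/

/-! ### Circles as unit vectors of a Lorentzian form -/

/-- The Lorentzian bilinear form on augmented curvature-center coordinates. -/
noncomputable def pairing (v v' : Fin 4 → ℝ) : ℝ :=
  v 2 * v' 2 + v 3 * v' 3 - (v 0 * v' 1 + v 1 * v' 0) / 2

/-- The curvature times the power of the point `z` with respect to the circle with coordinate
vector `v`: it vanishes on the circle and is negative in its interior. -/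
def power (v : Fin 4 → ℝ) (z : ℂ) : ℝ :=
  v 1 * (z.re ^ 2 + z.im ^ 2) - 2 * (v 2 * z.re + v 3 * z.im) + v 0

theorem power_add (v v' : Fin 4 → ℝ) (z : ℂ) : power (v + v') z = power v z + power v' z := by
  simp only [power, Pi.add_apply]; ring

theorem power_neg (v : Fin 4 → ℝ) (z : ℂ) : power (-v) z = -power v z := by
  simp only [power, Pi.neg_apply]; ring

theorem pairing_neg_neg (v v' : Fin 4 → ℝ) : pairing (-v) (-v') = pairing v v' := by
  simp only [pairing, Pi.neg_apply]; ring

namespace OrientedCircle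

theorem curvature_eq (C : OrientedCircle) : C.curvature = C.coords 1 := by
  cases C <;> simp [curvature, coords]

theorem coords_reverse (C : OrientedCircle) : C.reverse.coords = -C.coords := by
  cases C <;> ext i <;> fin_cases i <;> simp [reverse, coords, div_neg]; ring

theorem norm_sq_eq (z : ℂ) : ‖z‖ ^ 2 = z.re ^ 2 + z.im ^ 2 := by
  rw [← Complex.normSq_eq_norm_sq, Complex.normSq_apply]; ring

theorem pairing_self (C : OrientedCircle) : pairing C.coords C.coords = 1 := by
  cases C with
  | circle c ρ hρ =>
    simp only [pairing, coords, norm_sq_eq]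
    simp
    field_simp
    ring
  | line h m hh =>
    have := norm_sq_eq h
    rw [hh] at this
    simp [pairing, coords]
    linarith

theorem power_circle (c : ℂ) (ρ : ℝ) (hρ : ρ ≠ 0) (z : ℂ) :
    power (circle c ρ hρ).coords z = (‖z - c‖ ^ 2 - ρ ^ 2) / ρ := by
  simp only [power, coords, norm_sq_eq]
  simp
  field_simp
  ring

theorem power_line (h : ℂ) (m : ℝ) (hh : ‖h‖ = 1) (z : ℂ) :
    power (line h m hh).coords z = 2 * (m - (z.re * h.re + z.im * h.im)) := by
  simp [power, coords]
  ring

theorem coe_mem_points (C : OrientedCircle) (z : ℂ) :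
    (z : RiemannSphere) ∈ C.points ↔ power C.coords z = 0 := by
  cases C with
  | circle c ρ hρ =>
    rw [power_circle, div_eq_zero_iff, or_iff_left hρ, sub_eq_zero, sq_eq_sq_iff_abs_eq_abs,
      abs_norm]
    simp [points]
  | line h m hh =>
    rw [power_line]
    simp [points]
    constructor <;> intro h <;> linarith

theorem infty_mem_points (C : OrientedCircle) :
    (OnePoint.infty : RiemannSphere) ∈ C.points ↔ C.coords 1 = 0 := by
  cases C with
  | circle c ρ hρ => simp [points, coords, hρ]
  | line h m hh => simp [points, coords]

theorem coe_mem_interior (C : OrientedCircle) (z : ℂ) :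
    (z : RiemannSphere) ∈ C.interior ↔ power C.coords z < 0 := by
  cases C with
  | circle c ρ hρ =>
    rw [power_circle]
    rcases lt_or_gt_of_ne hρ with h | h
    · rw [div_neg_iff]
      simp only [interior, not_lt.mpr h.le, if_false]
      have h1 : -ρ < ‖z - c‖ ↔ ρ ^ 2 < ‖z - c‖ ^ 2 := by
        rw [← neg_sq ρ, sq_lt_sq₀ (by linarith) (norm_nonneg _)]
      simp [h1, h]
    · rw [div_neg_iff]
      simp only [interior, h, if_true]
      have h1 : ‖z - c‖ < ρ ↔ ‖z - c‖ ^ 2 < ρ ^ 2 := by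
        rw [sq_lt_sq₀ (norm_nonneg _) h.le]
      simp [h1, not_lt.mpr h.le]
  | line h m hh =>
    rw [power_line]
    simp [interior]
    constructor <;> intro h <;> linarith

theorem infty_mem_interior (C : OrientedCircle) :
    (OnePoint.infty : RiemannSphere) ∈ C.interior ↔ C.coords 1 < 0 := by
  cases C with
  | circle c ρ hρ =>
    rcases lt_or_gt_of_ne hρ with h | h
    · simp [interior, coords, not_lt.mpr h.le, h]
    · simp [interior, coords, not_lt.mpr h.le, h]
  | line h m hh => simp [interior, coords]

/-- The norm equation recovers the first coordinate from the other three when the curvature is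
nonzero; when it is zero, it makes the normal a unit vector. -/
theorem exists_coords_eq (v : Fin 4 → ℝ) (hv : pairing v v = 1) :
    ∃ C : OrientedCircle, C.coords = v := by
  simp only [pairing] at hv
  by_cases hb : v 1 = 0
  · refine ⟨line ⟨v 2, v 3⟩ (v 0 / 2) ?_, ?_⟩
    · rw [← sq_eq_sq₀ (norm_nonneg _) zero_le_one, norm_sq_eq]
      simp only [hb] at hv
      linarith
    · ext i
      fin_cases i <;> simp [coords, hb]
      ring
  · refine ⟨circle ⟨v 2 / v 1, v 3 / v 1⟩ (1 / v 1) (one_div_ne_zero hb), ?_⟩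
    ext i
    fin_cases i <;> simp [coords, norm_sq_eq, hb]
    field_simp
    linarith

/-- Circles with a common point and disjoint interiors have pairing `-1`. -/
theorem pairing_eq_neg_one {C C' : OrientedCircle} (hp : (C.points ∩ C'.points).Nonempty)
    (hd : Disjoint C.interior C'.interior) : pairing C.coords C'.coords = -1 := by
  have h1 := C.pairing_self
  have h2 := C'.pairing_self
  have hd' : ∀ z : ℂ, power C.coords z < 0 → ¬ power C'.coords z < 0 := fun z hz hz' =>
    Set.disjoint_left.mp hd ((C.coe_mem_interior z).mpr hz) ((C'.coe_mem_interior z).mpr hz')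
  obtain ⟨p, hp, hp'⟩ := hp
  set v := C.coords
  set w := C'.coords
  by_contra hne
  induction p using OnePoint.rec with
  | infty =>
    rw [infty_mem_points] at hp hp'
    change v 1 = 0 at hp
    change w 1 = 0 at hp'
    simp only [pairing, hp, hp'] at h1 h2 hne
    -- Both circles are lines with unit normals n, n'. Unless n' = -n, a point far out along n + n'
    -- lies in both half planes.
    have hs : 0 < 1 + (v 2 * w 2 + v 3 * w 3) := by
      refine lt_of_le_of_ne ?_ ?_
      · nlinarith [sq_nonneg (v 2 + w 2), sq_nonneg (v 3 + w 3)]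
      · intro h; apply hne; linarith
    set s := 1 + (v 2 * w 2 + v 3 * w 3)
    set t := (|v 0| + |w 0| + 1) / s with ht
    have hts : t * s = |v 0| + |w 0| + 1 := by rw [ht]; field_simp
    refine hd' ⟨t * (v 2 + w 2), t * (v 3 + w 3)⟩ ?_ ?_
    · have : power v ⟨t * (v 2 + w 2), t * (v 3 + w 3)⟩ = v 0 - 2 * (t * s) := by
        simp only [power, hp, s]; linear_combination (-2 * t) * h1
      rw [this, hts]
      linarith [le_abs_self (v 0), abs_nonneg (v 0), abs_nonneg (w 0)]
    · have : power w ⟨t * (v 2 + w 2), t * (v 3 + w 3)⟩ = w 0 - 2 * (t * s) := by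
        simp only [power, hp', s]; linear_combination (-2 * t) * h2
      rw [this, hts]
      linarith [le_abs_self (w 0), abs_nonneg (v 0), abs_nonneg (w 0)]
  | coe p =>
    rw [coe_mem_points] at hp hp'
    change power v p = 0 at hp
    change power w p = 0 at hp'
    set x := p.re with hx
    set y := p.im with hy
    simp only [pairing, power, ← hx, ← hy] at h1 h2 hne hp hp'
    set a := v 2 - v 1 * x with ha
    set b := v 3 - v 1 * y with hb
    set a' := w 2 - w 1 * x with ha'
    set b' := w 3 - w 1 * y with hb'
    -- (a, b) and (a', b') are the unit normals at the common point, pointing into the interiors.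
    -- Unless they are opposite, a short step along their sum enters both interiors; t is small
    -- enough to keep the quadratic term harmless.
    have e1 : a ^ 2 + b ^ 2 = 1 := by rw [ha, hb]; linear_combination h1 + v 1 * hp
    have e2 : a' ^ 2 + b' ^ 2 = 1 := by rw [ha', hb']; linear_combination h2 + w 1 * hp'
    have e3 : v 2 * w 2 + v 3 * w 3 - (v 0 * w 1 + v 1 * w 0) / 2 = a * a' + b * b' := by
      rw [ha, hb, ha', hb']; linear_combination (-w 1 / 2) * hp - (v 1 / 2) * hp'
    rw [e3] at hne
    have hs : 0 < 1 + (a * a' + b * b') := by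
      refine lt_of_le_of_ne ?_ ?_
      · nlinarith [sq_nonneg (a + a'), sq_nonneg (b + b')]
      · intro h; apply hne; linarith
    set t := 1 / (|v 1| + |w 1| + 1) with ht
    have hpos : 0 < |v 1| + |w 1| + 1 := by positivity
    have htp : 0 < t := by positivity
    have hb1 : v 1 * t < 1 := by
      rw [ht, mul_one_div, div_lt_one hpos]
      linarith [le_abs_self (v 1), abs_nonneg (w 1)]
    have hb2 : w 1 * t < 1 := by
      rw [ht, mul_one_div, div_lt_one hpos]
      linarith [le_abs_self (w 1), abs_nonneg (v 1)]
    refine hd' ⟨x + t * (a + a'), y + t * (b + b')⟩ ?_ ?_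
    · have : power v ⟨x + t * (a + a'), y + t * (b + b')⟩ =
          2 * t * (1 + (a * a' + b * b')) * (v 1 * t - 1) := by
        simp only [power]
        have : v 1 * ((x + t * (a + a')) ^ 2 + (y + t * (b + b')) ^ 2) -
            2 * (v 2 * (x + t * (a + a')) + v 3 * (y + t * (b + b'))) + v 0 =
            v 1 * t ^ 2 * ((a + a') ^ 2 + (b + b') ^ 2) -
              2 * t * (a * (a + a') + b * (b + b')) := by
          linear_combination hp - 2 * t * (a + a') * ha - 2 * t * (b + b') * hb
        rw [this]
        linear_combination (v 1 * t ^ 2 - 2 * t) * e1 + v 1 * t ^ 2 * e2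
      rw [this]
      exact mul_neg_of_pos_of_neg (by positivity) (by linarith)
    · have : power w ⟨x + t * (a + a'), y + t * (b + b')⟩ =
          2 * t * (1 + (a * a' + b * b')) * (w 1 * t - 1) := by
        simp only [power]
        have : w 1 * ((x + t * (a + a')) ^ 2 + (y + t * (b + b')) ^ 2) -
            2 * (w 2 * (x + t * (a + a')) + w 3 * (y + t * (b + b'))) + w 0 =
            w 1 * t ^ 2 * ((a + a') ^ 2 + (b + b') ^ 2) -
              2 * t * (a' * (a + a') + b' * (b + b')) := by
          linear_combination hp' - 2 * t * (a + a') * ha' - 2 * t * (b + b') * hb'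
        rw [this]
        linear_combination (w 1 * t ^ 2 - 2 * t) * e2 + w 1 * t ^ 2 * e1
      rw [this]
      exact mul_neg_of_pos_of_neg (by positivity) (by linarith)

end OrientedCircle

/-! ### Descartes configurations as frames -/

/-- The vectors `v 0, …, v 3` have norm `1` and mutual pairings `-1`. -/
def IsDescartesFrame (v : Fin 4 → Fin 4 → ℝ) : Prop :=
  ∀ i j, pairing (v i) (v j) = if i = j then 1 else -1

theorem DescartesConfiguration.isDescartesFrame (D : DescartesConfiguration) :
    IsDescartesFrame D.W := by
  intro i j
  change pairing (D.circles i).coords (D.circles j).coords = _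
  split_ifs with h
  · rw [h, OrientedCircle.pairing_self]
  · obtain ⟨p, hp⟩ := D.tangent i j h
    rcases D.oriented with ho | ho
    · exact OrientedCircle.pairing_eq_neg_one (hp ▸ Set.singleton_nonempty p) (ho i j h)
    · rw [← pairing_neg_neg, ← OrientedCircle.coords_reverse, ← OrientedCircle.coords_reverse]
      refine OrientedCircle.pairing_eq_neg_one ⟨p, ?_⟩ (ho i j h)
      have hp' : p ∈ (D.circles i).points ∩ (D.circles j).points := hp ▸ rfl
      have hrev : ∀ C : OrientedCircle, p ∈ C.points → p ∈ C.reverse.points := by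
        intro C hC
        induction p using OnePoint.rec with
        | infty =>
          rw [OrientedCircle.infty_mem_points] at hC ⊢
          simp [OrientedCircle.coords_reverse, hC]
        | coe p =>
          rw [OrientedCircle.coe_mem_points] at hC ⊢
          simp [OrientedCircle.coords_reverse, power_neg, hC]
      exact ⟨hrev _ hp'.1, hrev _ hp'.2⟩

/-- A lightlike or zero vector in the closed future cone. -/
def IsFutureNull (n : Fin 4 → ℝ) : Prop :=
  0 ≤ n 0 ∧ 0 ≤ n 1 ∧ pairing n n = 0

theorem isFutureNull_or_neg {n : Fin 4 → ℝ} (h : pairing n n = 0) :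
    IsFutureNull n ∨ IsFutureNull (-n) := by
  have h' : n 0 * n 1 = n 2 ^ 2 + n 3 ^ 2 := by simp only [pairing] at h; linarith
  have hm : 0 ≤ n 0 * n 1 := by rw [h']; positivity
  rcases mul_nonneg_iff.mp hm with ⟨h0, h1⟩ | ⟨h0, h1⟩
  · exact Or.inl ⟨h0, h1, h⟩
  · exact Or.inr ⟨by simpa using h0, by simpa using h1, by rw [pairing_neg_neg, h]⟩

/-- Reverse Cauchy–Schwarz on the light cone: the Cauchy inequality for the plane parts, then the
arithmetic-geometric mean inequality. -/
theorem IsFutureNull.pairing_nonpos {n n' : Fin 4 → ℝ} (h : IsFutureNull n)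
    (h' : IsFutureNull n') : pairing n n' ≤ 0 := by
  obtain ⟨h0, h1, hn⟩ := h
  obtain ⟨h0', h1', hn'⟩ := h'
  simp only [pairing] at *
  have e : (n 2 * n' 2 + n 3 * n' 3) ^ 2 ≤ ((n 0 * n' 1 + n 1 * n' 0) / 2) ^ 2 := by
    have e1 : n 0 * n 1 = n 2 ^ 2 + n 3 ^ 2 := by linarith
    have e2 : n' 0 * n' 1 = n' 2 ^ 2 + n' 3 ^ 2 := by linarith
    have e3 : (n 2 ^ 2 + n 3 ^ 2) * (n' 2 ^ 2 + n' 3 ^ 2) =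
      (n 0 * n' 1) * (n 1 * n' 0) := by rw [← e1, ← e2]; ring
    nlinarith [sq_nonneg (n 2 * n' 3 - n 3 * n' 2), sq_nonneg (n 0 * n' 1 - n 1 * n' 0)]
  have := abs_le_of_sq_le_sq' e (by positivity)
  linarith [this.2]

theorem IsFutureNull.power_nonneg {n : Fin 4 → ℝ} (h : IsFutureNull n) (z : ℂ) :
    0 ≤ power n z := by
  -- Points of the plane are null vectors, and the power at a point is -2 times the pairing with its
  -- vector.
  have : pairing n ![z.re ^ 2 + z.im ^ 2, 1, z.re, z.im] ≤ 0 := by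
    refine h.pairing_nonpos ⟨?_, ?_, ?_⟩ <;> simp [pairing]
    · positivity
    · ring
  simp [pairing] at this
  simp only [power]
  linarith

theorem disjoint_interior {C C' : OrientedCircle} (h : IsFutureNull (C.coords + C'.coords)) :
    Disjoint C.interior C'.interior := by
  rw [Set.disjoint_left]
  intro p hp hp'
  induction p using OnePoint.rec with
  | infty =>
    rw [OrientedCircle.infty_mem_interior] at hp hp'
    have := h.2.1
    simp only [Pi.add_apply] at this
    linarith
  | coe p =>
    rw [OrientedCircle.coe_mem_interior] at hp hp'
    have := h.power_nonneg p
    rw [power_add] at this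
    linarith

/-- The sum of the two vectors is null, so it represents a point of the sphere, the point of
tangency. A zero sum must be excluded: it is one circle with both orientations. -/
theorem exists_inter_eq_singleton {C C' : OrientedCircle}
    (h : pairing C.coords C'.coords = -1) (hne : C.coords + C'.coords ≠ 0) :
    ∃ p, C.points ∩ C'.points = {p} := by
  have h1 := C.pairing_self
  have h2 := C'.pairing_self
  have m0 := C.infty_mem_points
  have m0' := C'.infty_mem_points
  have m1 := C.coe_mem_points
  have m1' := C'.coe_mem_points
  set v := C.coords
  set w := C'.coords
  have hn : pairing (v + w) (v + w) = 0 := by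
    have : pairing (v + w) (v + w) = pairing v v + pairing w w + 2 * pairing v w := by
      simp only [pairing, Pi.add_apply]; ring
    rw [this, h1, h2, h]; ring
  simp only [pairing, Pi.add_apply] at hn h h1 h2
  by_cases hb : v 1 + w 1 = 0
  · have hsq : (v 2 + w 2) ^ 2 + (v 3 + w 3) ^ 2 = 0 := by
      linear_combination hn + (v 0 + w 0) * hb
    have e2 : v 2 + w 2 = 0 := by nlinarith [sq_nonneg (v 2 + w 2), sq_nonneg (v 3 + w 3)]
    have e3 : v 3 + w 3 = 0 := by nlinarith [sq_nonneg (v 2 + w 2), sq_nonneg (v 3 + w 3)]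
    have e0 : v 0 + w 0 ≠ 0 := by
      intro e0
      apply hne
      ext i
      fin_cases i <;> simp [e0, hb, e2, e3]
    have hw1 : w 1 = -v 1 := by linarith
    have hw2 : w 2 = -v 2 := by linarith
    have hw3 : w 3 = -v 3 := by linarith
    -- The two vectors are opposite except in coordinate 0, so equality of their norms gives this;
    -- the circles are parallel lines.
    have hv : v 1 = 0 := by
      have : v 1 * (v 0 + w 0) = 0 := by
        rw [hw1, hw2, hw3] at h2
        linear_combination h2 - h1
      exact (mul_eq_zero.mp this).resolve_right e0
    refine ⟨OnePoint.infty, ?_⟩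
    ext p
    induction p using OnePoint.rec with
    | infty =>
      simp only [Set.mem_inter_iff, m0, m0', Set.mem_singleton_iff, iff_true]
      exact ⟨hv, by rw [hw1, hv, neg_zero]⟩
    | coe p =>
      simp only [Set.mem_inter_iff, m1, m1', Set.mem_singleton_iff, OnePoint.coe_ne_infty,
        iff_false]
      rintro ⟨hp, hp'⟩
      apply e0
      simp only [power, hw1, hw2, hw3] at hp hp'
      linarith
  · refine ⟨((⟨(v 2 + w 2) / (v 1 + w 1), (v 3 + w 3) / (v 1 + w 1)⟩ : ℂ) : RiemannSphere), ?_⟩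
    ext p
    induction p using OnePoint.rec with
    | infty =>
      simp only [Set.mem_inter_iff, m0, m0', Set.mem_singleton_iff, OnePoint.infty_ne_coe,
        iff_false]
      rintro ⟨hp, hp'⟩
      exact hb (by rw [hp, hp', add_zero])
    | coe p =>
      simp only [Set.mem_inter_iff, m1, m1', Set.mem_singleton_iff, OnePoint.coe_eq_coe]
      constructor
      · rintro ⟨hp, hp'⟩
        simp only [power] at hp hp'
        have hsq : ((v 1 + w 1) * p.re - (v 2 + w 2)) ^ 2 +
            ((v 1 + w 1) * p.im - (v 3 + w 3)) ^ 2 = 0 := by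
          linear_combination (v 1 + w 1) * (hp + hp') + hn
        have f1 : (v 1 + w 1) * p.re - (v 2 + w 2) = 0 := by
          nlinarith [sq_nonneg ((v 1 + w 1) * p.re - (v 2 + w 2)),
            sq_nonneg ((v 1 + w 1) * p.im - (v 3 + w 3))]
        have f2 : (v 1 + w 1) * p.im - (v 3 + w 3) = 0 := by
          nlinarith [sq_nonneg ((v 1 + w 1) * p.re - (v 2 + w 2)),
            sq_nonneg ((v 1 + w 1) * p.im - (v 3 + w 3))]
        apply Complex.ext
        · simp only; rw [eq_div_iff hb]; linarith
        · simp only; rw [eq_div_iff hb]; linarith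
      · rintro rfl
        simp only [power]
        constructor
        · field_simp
          linear_combination v 1 * hn - 2 * (v 1 + w 1) * (h1 + h)
        · field_simp
          linear_combination w 1 * hn - 2 * (v 1 + w 1) * (h2 + h)

theorem add_sq_eq_zero {a b : ℝ} (h : a ^ 2 + b ^ 2 = 0) : a = 0 ∧ b = 0 := by
  rw [add_eq_zero_iff_of_nonneg (sq_nonneg a) (sq_nonneg b)] at h
  exact ⟨pow_eq_zero_iff two_ne_zero |>.mp h.1, pow_eq_zero_iff two_ne_zero |>.mp h.2⟩

/-- Three plane vectors that are pairwise antipodal vanish. -/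
theorem not_pairwise_antipodal {a b c d e f : ℝ} (h1 : (a + c) ^ 2 + (b + d) ^ 2 = 0)
    (h2 : (a + e) ^ 2 + (b + f) ^ 2 = 0) (h3 : (c + e) ^ 2 + (d + f) ^ 2 = 0)
    (h4 : a ^ 2 + b ^ 2 = 1) : False := by
  obtain ⟨g1, g2⟩ := add_sq_eq_zero h1
  obtain ⟨g3, g4⟩ := add_sq_eq_zero h2
  obtain ⟨g5, g6⟩ := add_sq_eq_zero h3
  have ha : a = 0 := by linarith
  have hb : b = 0 := by linarith
  rw [ha, hb] at h4
  norm_num at h4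

/-- At a common point the unit normals would be pairwise opposite, which is impossible for three
vectors. -/
theorem power_eq_zero_not_triple {u v w : Fin 4 → ℝ} (hu : pairing u u = 1)
    (hv : pairing v v = 1) (hw : pairing w w = 1) (huv : pairing u v = -1)
    (huw : pairing u w = -1) (hvw : pairing v w = -1) (z : ℂ) (pu : power u z = 0)
    (pv : power v z = 0) (pw : power w z = 0) : False := by
  simp only [pairing, power] at *
  have a2 : (u 2 - u 1 * z.re + (v 2 - v 1 * z.re)) ^ 2 +
      (u 3 - u 1 * z.im + (v 3 - v 1 * z.im)) ^ 2 = 0 := by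
    linear_combination hu + hv + 2 * huv + (u 1 + v 1) * (pu + pv)
  have b2 : (u 2 - u 1 * z.re + (w 2 - w 1 * z.re)) ^ 2 +
      (u 3 - u 1 * z.im + (w 3 - w 1 * z.im)) ^ 2 = 0 := by
    linear_combination hu + hw + 2 * huw + (u 1 + w 1) * (pu + pw)
  have c2 : (v 2 - v 1 * z.re + (w 2 - w 1 * z.re)) ^ 2 +
      (v 3 - v 1 * z.im + (w 3 - w 1 * z.im)) ^ 2 = 0 := by
    linear_combination hv + hw + 2 * hvw + (v 1 + w 1) * (pv + pw)
  have d2 : (u 2 - u 1 * z.re) ^ 2 + (u 3 - u 1 * z.im) ^ 2 = 1 := by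
    linear_combination hu + u 1 * pu
  exact not_pairwise_antipodal a2 b2 c2 d2

theorem curvature_eq_zero_not_triple {u v w : Fin 4 → ℝ} (hu : pairing u u = 1)
    (hv : pairing v v = 1) (hw : pairing w w = 1) (huv : pairing u v = -1)
    (huw : pairing u w = -1) (hvw : pairing v w = -1) (pu : u 1 = 0)
    (pv : v 1 = 0) (pw : w 1 = 0) : False := by
  -- exchange the roles of the curvature and the dual curvature: inversion moves `∞` to `0`
  have sw : ∀ x y : Fin 4 → ℝ,
      pairing ![x 1, x 0, x 2, x 3] ![y 1, y 0, y 2, y 3] = pairing x y := by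
    intro x y; simp [pairing]; ring
  refine power_eq_zero_not_triple (u := ![u 1, u 0, u 2, u 3]) (v := ![v 1, v 0, v 2, v 3])
    (w := ![w 1, w 0, w 2, w 3]) ?_ ?_ ?_ ?_ ?_ ?_ 0 ?_ ?_ ?_
  all_goals first | rw [sw]; assumption | simpa [power]

theorem IsDescartesFrame.pairing_add {v : Fin 4 → Fin 4 → ℝ} (hv : IsDescartesFrame v)
    (i j k l : Fin 4) :
    pairing (v i + v j) (v k + v l) =
      (if i = k then 1 else -1) + (if i = l then 1 else -1) +
      (if j = k then 1 else -1) + (if j = l then 1 else -1) := by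
  rw [← hv i k, ← hv i l, ← hv j k, ← hv j l]
  simp only [pairing, Pi.add_apply]; ring

/-- The six sums of two frame vectors are nonzero and null, and sums over distinct pairs have
pairing -2 or -4. Hence all six lie in the same half of the light cone, and that half decides the
total orientation. -/
theorem IsDescartesFrame.exists_configuration {v : Fin 4 → Fin 4 → ℝ} (hv : IsDescartesFrame v) :
    ∃ D : DescartesConfiguration, D.W = v := by
  have h1 : ∀ i, pairing (v i) (v i) = 1 := fun i => by rw [hv, if_pos rfl]
  have h2 : ∀ i j, i ≠ j → pairing (v i) (v j) = -1 := fun i j h => by rw [hv, if_neg h]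
  choose C hC using fun i => OrientedCircle.exists_coords_eq (v i) (h1 i)
  have hne : ∀ i j, i ≠ j → v i + v j ≠ 0 := by
    intro i j hij h0
    have hthird : ∀ i j : Fin 4, ∃ k : Fin 4, k ≠ i ∧ k ≠ j := by decide
    obtain ⟨k, hki, hkj⟩ := hthird i j
    have e : pairing (v i) (v k) + pairing (v j) (v k) = pairing (v i + v j) (v k) := by
      simp only [pairing, Pi.add_apply]; ring
    rw [h0, h2 i k hki.symm, h2 j k hkj.symm] at e
    norm_num [pairing] at e
  have hnull : ∀ i j, i ≠ j → pairing (v i + v j) (v i + v j) = 0 := by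
    intro i j hij
    rw [hv.pairing_add]
    simp [hij, hij.symm]
  have hneg : ∀ i j k l, i ≠ j → k ≠ l → IsFutureNull (v i + v j) →
      IsFutureNull (v k + v l) := by
    intro i j k l hij hkl hf
    rcases isFutureNull_or_neg (hnull k l hkl) with h | h
    · exact h
    · by_cases hs : (i = k ∧ j = l) ∨ (i = l ∧ j = k)
      · rcases hs with ⟨rfl, rfl⟩ | ⟨rfl, rfl⟩
        · exact hf
        · rwa [add_comm]
      -- A future and a past null vector pair nonnegatively, against the value -2 or -4.
      · have := hf.pairing_nonpos h
        have e : pairing (v i + v j) (-(v k + v l)) = -pairing (v i + v j) (v k + v l) := by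
          simp only [pairing, Pi.neg_apply]; ring
        rw [e, hv.pairing_add] at this
        exfalso
        split_ifs at this <;> first | linarith | grind
  refine ⟨⟨C, ?_, ?_, ?_⟩, ?_⟩
  · intro i j hij
    apply exists_inter_eq_singleton
    · rw [hC, hC, h2 i j hij]
    · rw [hC, hC]; exact hne i j hij
  · intro i j k hij hjk hik
    rw [Set.eq_empty_iff_forall_notMem]
    rintro p ⟨⟨hi, hj⟩, hk⟩
    induction p using OnePoint.rec with
    | infty =>
      rw [OrientedCircle.infty_mem_points, hC] at hi hj hk
      exact curvature_eq_zero_not_triple (h1 i) (h1 j) (h1 k) (h2 i j hij) (h2 i k hik)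
        (h2 j k hjk) hi hj hk
    | coe p =>
      rw [OrientedCircle.coe_mem_points, hC] at hi hj hk
      exact power_eq_zero_not_triple (h1 i) (h1 j) (h1 k) (h2 i j hij) (h2 i k hik)
        (h2 j k hjk) p hi hj hk
  · have h01 : (0 : Fin 4) ≠ 1 := by decide
    rcases isFutureNull_or_neg (hnull 0 1 h01) with h | h
    · left
      intro i j hij
      apply disjoint_interior
      rw [hC, hC]
      exact hneg 0 1 i j h01 hij h
    · right
      intro i j hij
      apply disjoint_interior
      rw [OrientedCircle.coords_reverse, OrientedCircle.coords_reverse, hC, hC, ← neg_add]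
      -- If this sum were future, the sum for 0 and 1 would be both future and past, hence zero.
      rcases isFutureNull_or_neg (hnull i j hij) with h' | h'
      · have h'' := hneg i j 0 1 hij h01 h'
        exfalso
        apply hne 0 1 h01
        have q0 := h.1
        have q1 := h.2.1
        have r0 := h''.1
        have r1 := h''.2.1
        have r2 := h''.2.2
        simp only [Pi.neg_apply] at q0 q1
        generalize v 0 + v 1 = n at *
        simp only [pairing] at r2
        have z0 : n 0 = 0 := by linarith
        have z1 : n 1 = 0 := by linarith
        rw [z0, z1] at r2
        have z2 : n 2 = 0 := by nlinarith [sq_nonneg (n 2), sq_nonneg (n 3)]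
        have z3 : n 3 = 0 := by nlinarith [sq_nonneg (n 2), sq_nonneg (n 3)]
        ext i
        fin_cases i <;> simp [z0, z1, z2, z3]
      · exact h'
  · funext i
    exact hC i

/-! ### The group action and its orbits -/

/-- The Gram matrix of a Descartes frame. -/
def gramMatrix : Matrix (Fin 4) (Fin 4) ℤ := Matrix.of fun i j => if i = j then 1 else -1

theorem mul_gramMatrix_mul_transpose {U : Matrix.GeneralLinearGroup (Fin 4) ℤ}
    (hU : U ∈ superApollonianGroup) :
    (U : Matrix (Fin 4) (Fin 4) ℤ) * gramMatrix * (U : Matrix (Fin 4) (Fin 4) ℤ).transpose =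
      gramMatrix := by
  induction hU using Subgroup.closure_induction with
  | mem x hx =>
    rcases hx with ⟨i, rfl⟩ | ⟨i, rfl⟩
    · change SMatrix i * gramMatrix * (SMatrix i).transpose = gramMatrix
      revert i; decide
    · change (SMatrix i).transpose * gramMatrix * (SMatrix i).transpose.transpose = gramMatrix
      revert i; decide
  | one => simp
  | mul x y _ _ hx hy =>
    calc ((x * y : Matrix.GeneralLinearGroup (Fin 4) ℤ) : Matrix (Fin 4) (Fin 4) ℤ) * gramMatrix *
          ((x * y : Matrix.GeneralLinearGroup (Fin 4) ℤ) : Matrix (Fin 4) (Fin 4) ℤ).transpose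
        = x.val * (y.val * gramMatrix * y.val.transpose) * x.val.transpose := by
          simp only [Units.val_mul, Matrix.transpose_mul, Matrix.mul_assoc]
      _ = gramMatrix := by rw [hy, hx]
  | inv x _ hx =>
    have h1 : x⁻¹.val * x.val = 1 := x.inv_mul
    have h2 : x.val.transpose * x⁻¹.val.transpose = 1 := by
      rw [← Matrix.transpose_mul, h1, Matrix.transpose_one]
    calc x⁻¹.val * gramMatrix * x⁻¹.val.transpose
        = x⁻¹.val * (x.val * gramMatrix * x.val.transpose) * x⁻¹.val.transpose := by rw [hx]
      _ = (x⁻¹.val * x.val) * gramMatrix * (x.val.transpose * x⁻¹.val.transpose) := by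
          simp only [Matrix.mul_assoc]
      _ = gramMatrix := by rw [h1, h2, Matrix.one_mul, Matrix.mul_one]

/-- The matrix of `pairing`. -/
noncomputable def pairingMatrix : Matrix (Fin 4) (Fin 4) ℝ :=
  !![0, -1 / 2, 0, 0; -1 / 2, 0, 0, 0; 0, 0, 1, 0; 0, 0, 0, 1]

/-- The real matrix with the same entries as an element of `GL(4, ℤ)`. -/
def realMatrix (U : Matrix.GeneralLinearGroup (Fin 4) ℤ) : Matrix (Fin 4) (Fin 4) ℝ :=
  (U : Matrix (Fin 4) (Fin 4) ℤ).map (fun n : ℤ => (n : ℝ))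

theorem map_intCast_mul (A B : Matrix (Fin 4) (Fin 4) ℤ) :
    (A * B).map (fun n : ℤ => (n : ℝ)) =
      A.map (fun n : ℤ => (n : ℝ)) * B.map (fun n : ℤ => (n : ℝ)) :=
  Matrix.map_mul (f := Int.castRingHom ℝ)

theorem realMatrix_mul (U V : Matrix.GeneralLinearGroup (Fin 4) ℤ) :
    realMatrix (U * V) = realMatrix U * realMatrix V :=
  map_intCast_mul _ _

theorem realMatrix_one : realMatrix 1 = 1 := by
  simp [realMatrix]

theorem isDescartesFrame_iff (W : Matrix (Fin 4) (Fin 4) ℝ) :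
    IsDescartesFrame W ↔
      W * pairingMatrix * W.transpose = gramMatrix.map (fun n : ℤ => (n : ℝ)) := by
  have h : ∀ i j, (W * pairingMatrix * W.transpose) i j = pairing (W i) (W j) := by
    intro i j
    simp [Matrix.mul_apply, Fin.sum_univ_four, pairingMatrix, pairing]
    ring
  rw [← Matrix.ext_iff]
  refine forall_congr' fun i => forall_congr' fun j => ?_
  rw [h]
  simp [gramMatrix]

theorem IsDescartesFrame.realMatrix_mul {U : Matrix.GeneralLinearGroup (Fin 4) ℤ}
    (hU : U ∈ superApollonianGroup) {W : Matrix (Fin 4) (Fin 4) ℝ} (hW : IsDescartesFrame W) :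
    IsDescartesFrame (realMatrix U * W) := by
  rw [isDescartesFrame_iff] at hW ⊢
  calc realMatrix U * W * pairingMatrix * (realMatrix U * W).transpose
      = realMatrix U * (W * pairingMatrix * W.transpose) * (realMatrix U).transpose := by
        simp only [Matrix.transpose_mul, Matrix.mul_assoc]
    _ = _ := by
        rw [hW, realMatrix, ← Matrix.transpose_map, ← map_intCast_mul, ← map_intCast_mul,
          mul_gramMatrix_mul_transpose hU]

theorem mem_superOrbit {D D' : DescartesConfiguration} :
    D' ∈ superOrbit D ↔ ∃ U ∈ superApollonianGroup, D'.W = realMatrix U * D.W := Iff.rfl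

/-- Orbits are defined by an equation between coordinate matrices; this supplies the configuration,
so that every group element really acts. -/
theorem exists_mem_superOrbit (D : DescartesConfiguration)
    {U : Matrix.GeneralLinearGroup (Fin 4) ℤ} (hU : U ∈ superApollonianGroup) :
    ∃ D' ∈ superOrbit D, D'.W = realMatrix U * D.W := by
  obtain ⟨D', h⟩ := (D.isDescartesFrame.realMatrix_mul hU).exists_configuration
  exact ⟨D', ⟨U, hU, h⟩, h⟩

theorem self_mem_superOrbit (D : DescartesConfiguration) : D ∈ superOrbit D :=
  mem_superOrbit.mpr ⟨1, one_mem _, by rw [realMatrix_one, Matrix.one_mul]⟩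

theorem superOrbit_trans {D D' D'' : DescartesConfiguration} (h : D' ∈ superOrbit D)
    (h' : D'' ∈ superOrbit D') : D'' ∈ superOrbit D := by
  rw [mem_superOrbit] at *
  obtain ⟨U, hU, h⟩ := h
  obtain ⟨V, hV, h'⟩ := h'
  exact ⟨V * U, mul_mem hV hU, by rw [h', h, realMatrix_mul, Matrix.mul_assoc]⟩

theorem superOrbit_symm {D D' : DescartesConfiguration} (h : D' ∈ superOrbit D) :
    D ∈ superOrbit D' := by
  rw [mem_superOrbit] at *
  obtain ⟨U, hU, h⟩ := h
  exact ⟨U⁻¹, inv_mem hU, by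
    rw [h, ← Matrix.mul_assoc, ← realMatrix_mul, inv_mul_cancel, realMatrix_one, Matrix.one_mul]⟩

theorem superOrbit_eq {D D' : DescartesConfiguration} (h : D' ∈ superOrbit D) :
    superOrbit D = superOrbit D' := by
  ext E
  exact ⟨superOrbit_trans (superOrbit_symm h), superOrbit_trans h⟩

/-- The automorphism of `GL(4, ℤ)` that permutes rows and columns. -/
def permConj (σ : Equiv.Perm (Fin 4)) :
    Matrix.GeneralLinearGroup (Fin 4) ℤ →* Matrix.GeneralLinearGroup (Fin 4) ℤ :=
  Units.map (Matrix.reindexAlgEquiv ℤ ℤ σ.symm).toMulEquiv.toMonoidHom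

theorem permConj_apply (σ : Equiv.Perm (Fin 4)) (U : Matrix.GeneralLinearGroup (Fin 4) ℤ) :
    (permConj σ U).val = U.val.submatrix σ σ := rfl

/-- Relabelling the circles permutes the generators. The descent ends with its curvatures in an
unknown order, so the orbit must be compared with that of a reordered configuration. -/
theorem permConj_mem (σ : Equiv.Perm (Fin 4)) {U : Matrix.GeneralLinearGroup (Fin 4) ℤ}
    (hU : U ∈ superApollonianGroup) : permConj σ U ∈ superApollonianGroup := by
  suffices h : superApollonianGroup ≤ superApollonianGroup.comap (permConj σ) from h hU
  refine (Subgroup.closure_le _).mpr ?_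
  have hS : ∀ i, (SMatrix i).submatrix σ σ = SMatrix (σ.symm i) := by
    intro i
    ext j k
    simp only [SMatrix, Matrix.submatrix_apply, Matrix.of_apply, Equiv.eq_symm_apply,
      σ.injective.eq_iff]
  rintro _ (⟨i, rfl⟩ | ⟨i, rfl⟩)
  · refine Subgroup.subset_closure (Or.inl ⟨σ.symm i, Units.ext ?_⟩)
    exact (hS i).symm
  · refine Subgroup.subset_closure (Or.inr ⟨σ.symm i, Units.ext ?_⟩)
    exact congrArg Matrix.transpose (hS i).symm

theorem permConj_mul_submatrix (σ : Equiv.Perm (Fin 4))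
    (U : Matrix.GeneralLinearGroup (Fin 4) ℤ) (W : Matrix (Fin 4) (Fin 4) ℝ) :
    realMatrix (permConj σ U) * W.submatrix σ id = (realMatrix U * W).submatrix σ id := by
  have : realMatrix (permConj σ U) = (realMatrix U).submatrix σ σ := by
    ext i j; simp [realMatrix, permConj_apply]
  rw [this, Matrix.submatrix_mul_equiv]

/-! ### Curvatures: gcd and Descartes relation -/

/-- Curvature vectors transform by the same integer matrices. -/
theorem curvature_mulVec {D D' : DescartesConfiguration}
    {U : Matrix.GeneralLinearGroup (Fin 4) ℤ} (h : D'.W = realMatrix U * D.W) {b : Fin 4 → ℤ}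
    (hb : ∀ i, (D.circles i).curvature = b i) (i : Fin 4) :
    (D'.circles i).curvature = (U.val.mulVec b i : ℤ) := by
  rw [OrientedCircle.curvature_eq]
  have : (D'.circles i).coords 1 = (realMatrix U * D.W) i 1 := by rw [← h]; rfl
  rw [this, Matrix.mul_apply, Matrix.mulVec, dotProduct, Int.cast_sum]
  refine Finset.sum_congr rfl fun j _ => ?_
  rw [Int.cast_mul, ← hb, OrientedCircle.curvature_eq]
  rfl

theorem gcd_dvd_gcd_mulVec (A : Matrix (Fin 4) (Fin 4) ℤ) (b : Fin 4 → ℤ) :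
    Finset.univ.gcd b ∣ Finset.univ.gcd (A.mulVec b) :=
  Finset.dvd_gcd fun i _ => by
    rw [Matrix.mulVec, dotProduct]
    exact Finset.dvd_sum fun j _ => (Finset.gcd_dvd (Finset.mem_univ j)).mul_left _

/-- The matrix and its inverse are both integral, so each gcd divides the other. -/
theorem gcd_mulVec (U : Matrix.GeneralLinearGroup (Fin 4) ℤ) (b : Fin 4 → ℤ) :
    Finset.univ.gcd (U.val.mulVec b) = Finset.univ.gcd b := by
  have h := gcd_dvd_gcd_mulVec U⁻¹.val (U.val.mulVec b)
  rw [Matrix.mulVec_mulVec, U.inv_mul, Matrix.one_mulVec] at h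
  have h' := associated_of_dvd_dvd h (gcd_dvd_gcd_mulVec U.val b)
  have := normalize_eq_normalize_iff_associated.mpr h'
  rwa [Finset.normalize_gcd, Finset.normalize_gcd] at this

theorem DescartesConfiguration.HasDivisor.of_mem_superOrbit {D D' : DescartesConfiguration}
    {g : ℕ} (h : D.HasDivisor g) (h' : D' ∈ superOrbit D) : D'.HasDivisor g := by
  obtain ⟨b, hb, hg⟩ := h
  obtain ⟨U, -, hU⟩ := h'
  exact ⟨U.val.mulVec b, curvature_mulVec hU hb, by rw [gcd_mulVec, hg]⟩

/-- The Descartes relation between the curvatures of a Descartes frame. -/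
theorem IsDescartesFrame.descartes_relation {W : Matrix (Fin 4) (Fin 4) ℝ}
    (hW : IsDescartesFrame W) : 2 * ∑ i, W i 1 ^ 2 = (∑ i, W i 1) ^ 2 := by
  set G : Matrix (Fin 4) (Fin 4) ℝ := gramMatrix.map (fun n : ℤ => (n : ℝ)) with hG
  have h := (isDescartesFrame_iff W).mp hW
  -- With P for `pairingMatrix`, inverting W P Wᵀ = G gives Wᵀ (G/4) W = P⁻¹. Since G is twice the
  -- identity minus the all-ones matrix, the (1,1) entry, where P⁻¹ vanishes, is the claimed
  -- relation.
  have hGG : G * G = (4 : ℝ) • (1 : Matrix (Fin 4) (Fin 4) ℝ) := by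
    ext i j
    fin_cases i <;> fin_cases j <;>
      simp [hG, gramMatrix, Matrix.mul_apply, Fin.sum_univ_four] <;> norm_num
  have h1 : W * (pairingMatrix * W.transpose * ((1 / 4 : ℝ) • G)) = 1 := by
    rw [← Matrix.mul_assoc, ← Matrix.mul_assoc, h, ← hG, Matrix.mul_smul, hGG, smul_smul]
    norm_num
  have h2 := mul_eq_one_comm.mp h1
  have hQ : (!![0, -2, 0, 0; -2, 0, 0, 0; 0, 0, 1, 0; 0, 0, 0, 1] : Matrix (Fin 4) (Fin 4) ℝ) *
      pairingMatrix = 1 := by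
    ext i j
    fin_cases i <;> fin_cases j <;>
      simp [pairingMatrix, Matrix.mul_apply, Fin.sum_univ_four] <;> norm_num
  have h3 : W.transpose * ((1 / 4 : ℝ) • G) * W =
      !![0, -2, 0, 0; -2, 0, 0, 0; 0, 0, 1, 0; 0, 0, 0, 1] := by
    calc W.transpose * ((1 / 4 : ℝ) • G) * W
        = (!![0, -2, 0, 0; -2, 0, 0, 0; 0, 0, 1, 0; 0, 0, 0, 1] * pairingMatrix) *
            (W.transpose * ((1 / 4 : ℝ) • G) * W) := by rw [hQ, Matrix.one_mul]
      _ = !![0, -2, 0, 0; -2, 0, 0, 0; 0, 0, 1, 0; 0, 0, 0, 1] *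
            (pairingMatrix * W.transpose * ((1 / 4 : ℝ) • G) * W) := by
          simp only [Matrix.mul_assoc]
      _ = _ := by rw [h2, Matrix.mul_one]
  have h4 := congrFun (congrFun h3 1) 1
  simp [Matrix.mul_apply, Fin.sum_univ_four, hG, gramMatrix] at h4
  simp only [Fin.sum_univ_four]
  linarith

theorem descartes_relation {D : DescartesConfiguration} {b : Fin 4 → ℤ}
    (hb : ∀ i, (D.circles i).curvature = b i) : 2 * ∑ i, b i ^ 2 = (∑ i, b i) ^ 2 := by
  have h := D.isDescartesFrame.descartes_relation
  have h' : ∀ i, D.W i 1 = b i := fun i => by rw [← hb, OrientedCircle.curvature_eq]; rfl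
  simp only [h'] at h
  exact_mod_cast h

/-! ### Reduction of integral curvature quadruples -/

theorem mulVec_S (i j : Fin 4) (b : Fin 4 → ℤ) :
    (S i).val.mulVec b j = if j = i then 2 * ∑ k, b k - 3 * b i else b j := by
  change (SMatrix i).mulVec b j = _
  fin_cases i <;> fin_cases j <;>
    simp [SMatrix, Matrix.mulVec, dotProduct, Fin.sum_univ_four] <;> ring

theorem mulVec_SPerp (i j : Fin 4) (b : Fin 4 → ℤ) :
    (SPerp i).val.mulVec b j = if j = i then -b i else b j + 2 * b i := by
  change (SMatrix i).transpose.mulVec b j = _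
  fin_cases i <;> fin_cases j <;>
    simp [SMatrix, Matrix.mulVec, dotProduct, Fin.sum_univ_four] <;> ring

theorem sum_mulVec_S (i : Fin 4) (b : Fin 4 → ℤ) :
    ∑ j, (S i).val.mulVec b j = 3 * ∑ k, b k - 4 * b i := by
  simp only [mulVec_S, Fin.sum_univ_four]
  fin_cases i <;> simp <;> ring

theorem sum_mulVec_SPerp (i : Fin 4) (b : Fin 4 → ℤ) :
    ∑ j, (SPerp i).val.mulVec b j = ∑ k, b k + 4 * b i := by
  simp only [mulVec_SPerp, Fin.sum_univ_four]
  fin_cases i <;> simp <;> ring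

theorem relation_mulVec_S (i : Fin 4) {b : Fin 4 → ℤ} (h : 2 * ∑ i, b i ^ 2 = (∑ i, b i) ^ 2) :
    2 * ∑ j, (S i).val.mulVec b j ^ 2 = (∑ j, (S i).val.mulVec b j) ^ 2 := by
  rw [sum_mulVec_S]
  simp only [mulVec_S, Fin.sum_univ_four] at *
  fin_cases i <;> simp <;> linear_combination h

theorem relation_mulVec_SPerp (i : Fin 4) {b : Fin 4 → ℤ}
    (h : 2 * ∑ i, b i ^ 2 = (∑ i, b i) ^ 2) :
    2 * ∑ j, (SPerp i).val.mulVec b j ^ 2 = (∑ j, (SPerp i).val.mulVec b j) ^ 2 := by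
  rw [sum_mulVec_SPerp]
  simp only [mulVec_SPerp, Fin.sum_univ_four] at *
  fin_cases i <;> simp <;> linear_combination h

/-- The bound for a single entry that the Descartes relation and Cauchy's inequality give. -/
theorem entry_bound {b : Fin 4 → ℤ} (h : 2 * ∑ i, b i ^ 2 = (∑ i, b i) ^ 2) (i : Fin 4) :
    8 * b i ^ 2 ≤ (∑ j, b j) ^ 2 + 4 * b i * ∑ j, b j := by
  simp only [Fin.sum_univ_four] at *
  fin_cases i <;> simp only [Fin.zero_eta, Fin.mk_one, Fin.reduceFinMk]
  · nlinarith [sq_nonneg (b 1 - b 2), sq_nonneg (b 1 - b 3), sq_nonneg (b 2 - b 3)]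
  · nlinarith [sq_nonneg (b 0 - b 2), sq_nonneg (b 0 - b 3), sq_nonneg (b 2 - b 3)]
  · nlinarith [sq_nonneg (b 0 - b 1), sq_nonneg (b 0 - b 3), sq_nonneg (b 1 - b 3)]
  · nlinarith [sq_nonneg (b 0 - b 1), sq_nonneg (b 0 - b 2), sq_nonneg (b 1 - b 2)]

/-- A quadruple to which no reduction step applies. -/
theorem exists_perm_of_reduced {b : Fin 4 → ℤ} (h : 2 * ∑ i, b i ^ 2 = (∑ i, b i) ^ 2)
    (hpos : 0 < ∑ i, b i) (h0 : ∀ i, 0 ≤ b i) (h1 : ∀ i, 2 * b i ≤ ∑ j, b j) :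
    ∃ (σ : Equiv.Perm (Fin 4)) (m : ℤ), 0 < m ∧ b ∘ σ = ![0, 0, m, m] := by
  set L := ∑ i, b i with hL
  -- The relation says that these terms sum to 0, and none is negative. So each entry is 0 or half
  -- the sum, and exactly two are half the sum.
  have hterm : ∀ i, b i * (L - 2 * b i) = 0 := by
    have hsum : ∑ i, b i * (L - 2 * b i) = 0 := by
      have : ∑ i, b i * (L - 2 * b i) = (∑ i, b i) * L - 2 * ∑ i, b i ^ 2 := by
        rw [Finset.sum_mul, Finset.mul_sum, ← Finset.sum_sub_distrib]
        exact Finset.sum_congr rfl fun i _ => by ring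
      rw [this, h, ← hL]; ring
    intro i
    exact (Finset.sum_eq_zero_iff_of_nonneg fun i _ =>
      mul_nonneg (h0 i) (sub_nonneg.mpr (h1 i))).mp hsum i (Finset.mem_univ i)
  have hcase : ∀ i, b i = 0 ∨ 2 * b i = L := fun i => by
    rcases mul_eq_zero.mp (hterm i) with h | h
    · exact Or.inl h
    · right; linarith
  have hinj : ∀ i j k l : Fin 4, [i, j, k, l].Nodup → Function.Injective ![i, j, k, l] := by
    decide
  have hp : ∀ i j k l : Fin 4, [i, j, k, l].Nodup → b i = 0 → b j = 0 → 2 * b k = L →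
      2 * b l = L → ∃ (σ : Equiv.Perm (Fin 4)) (m : ℤ), 0 < m ∧ b ∘ σ = ![0, 0, m, m] := by
    intro i j k l hn hi hj hk hl
    refine ⟨Equiv.ofBijective _ (Finite.injective_iff_bijective.mp (hinj i j k l hn)), b k, by omega, ?_⟩
    ext t
    fin_cases t <;> simp [hi, hj]
    omega
  rw [Fin.sum_univ_four] at hL
  rcases hcase 0 with a | a <;> rcases hcase 1 with b | b <;> rcases hcase 2 with c | c <;>
    rcases hcase 3 with d | d
  all_goals first
    | (exfalso; omega)
    | exact hp 0 1 2 3 (by decide) a b c d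
    | exact hp 0 2 1 3 (by decide) a c b d
    | exact hp 0 3 1 2 (by decide) a d b c
    | exact hp 1 2 0 3 (by decide) b c a d
    | exact hp 1 3 0 2 (by decide) b d a c
    | exact hp 2 3 0 1 (by decide) c d a b

/-- Descent on the sum of the curvatures, a positive integer; `n` only bounds it for the induction.
-/
theorem exists_reduction (n : ℕ) : ∀ b : Fin 4 → ℤ, 2 * ∑ i, b i ^ 2 = (∑ i, b i) ^ 2 →
    0 < ∑ i, b i → ∑ i, b i ≤ n → ∃ U ∈ superApollonianGroup,
      ∃ (σ : Equiv.Perm (Fin 4)) (m : ℤ), 0 < m ∧ U.val.mulVec b ∘ σ = ![0, 0, m, m] := by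
  induction n with
  | zero => intro b _ h h'; push_cast at h'; omega
  | succ n ih =>
    intro b h hpos hn
    have step : ∀ V ∈ superApollonianGroup,
        2 * ∑ j, V.val.mulVec b j ^ 2 = (∑ j, V.val.mulVec b j) ^ 2 →
        0 < ∑ j, V.val.mulVec b j → ∑ j, V.val.mulVec b j < ∑ j, b j →
        ∃ U ∈ superApollonianGroup, ∃ (σ : Equiv.Perm (Fin 4)) (m : ℤ),
          0 < m ∧ U.val.mulVec b ∘ σ = ![0, 0, m, m] := by
      intro V hV h1 h2 h3
      obtain ⟨U, hU, σ, m, hm, he⟩ := ih (V.val.mulVec b) h1 h2 (by push_cast at hn; omega)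
      refine ⟨U * V, mul_mem hU hV, σ, m, hm, ?_⟩
      rw [Units.val_mul, ← Matrix.mulVec_mulVec, he]
    by_cases h0 : ∀ i, 0 ≤ b i
    · by_cases h1 : ∀ i, 2 * b i ≤ ∑ j, b j
      · obtain ⟨σ, m, hm, he⟩ := exists_perm_of_reduced h hpos h0 h1
        exact ⟨1, one_mem _, σ, m, hm, by simpa using he⟩
      · push Not at h1
        obtain ⟨i, hi⟩ := h1
        -- With L the sum, the bound gives b i ≤ (1+√3)L/4 < 3L/4, so the new sum 3L - 4 b i stays
        -- positive; it is below L because 2 b i > L.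
        have hbd := entry_bound h i
        refine step (S i) (Subgroup.subset_closure (Or.inl ⟨i, rfl⟩)) (relation_mulVec_S i h) ?_ ?_
        · rw [sum_mulVec_S]; nlinarith
        · rw [sum_mulVec_S]; linarith
    · push Not at h0
      obtain ⟨i, hi⟩ := h0
      -- Here the bound gives b i ≥ (1-√3)L/4 > -L/4, so the new sum L + 4 b i is positive, and
      -- smaller since b i < 0.
      have hbd := entry_bound h i
      refine step (SPerp i) (Subgroup.subset_closure (Or.inr ⟨i, rfl⟩))
        (relation_mulVec_SPerp i h) ?_ ?_
      · rw [sum_mulVec_SPerp]; nlinarith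
      · rw [sum_mulVec_SPerp]; linarith

/-! ### Euclidean motions on circles and super-packings -/

theorem motion_trans (φ ψ : ℂ ≃ᵢ ℂ) : motion (φ.trans ψ) = motion ψ ∘ motion φ := by
  funext x
  induction x using OnePoint.rec <;> rfl

theorem motion_refl : motion (IsometryEquiv.refl ℂ) = id := by
  funext x
  induction x using OnePoint.rec <;> rfl

theorem motion_surjective (φ : ℂ ≃ᵢ ℂ) : Function.Surjective (motion φ) := by
  intro x
  refine ⟨motion φ.symm x, ?_⟩
  rw [← Function.comp_apply (f := motion φ), ← motion_trans, show φ.symm.trans φ = IsometryEquiv.refl ℂ from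
    IsometryEquiv.ext fun z => φ.apply_symm_apply z, motion_refl, id]

theorem motionCircles_trans (φ ψ : ℂ ≃ᵢ ℂ) :
    motionCircles (φ.trans ψ) = motionCircles ψ ∘ motionCircles φ := by
  funext K
  simp only [motionCircles, motion_trans, Function.comp_apply, Set.image_image]

theorem motionCircles_refl : motionCircles (IsometryEquiv.refl ℂ) = id := by
  funext K
  simp [motionCircles, motion_refl]

theorem geometricCircles_eq_sUnion (P : Set DescartesConfiguration) :
    geometricCircles P = ⋃₀ geometricConfigurations P := by
  ext C
  simp only [geometricCircles, geometricConfigurations, Set.mem_sUnion, Set.mem_ofPred_eq]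
  constructor
  · rintro ⟨D, hD, hC⟩; exact ⟨_, ⟨D, hD, rfl⟩, hC⟩
  · rintro ⟨_, ⟨D, hD, rfl⟩, hC⟩; exact ⟨D, hD, hC⟩

theorem geometricPointSet_eq_sUnion (P : Set DescartesConfiguration) :
    geometricPointSet P = ⋃₀ geometricCircles P := rfl

theorem image_geometricCircles {φ : ℂ ≃ᵢ ℂ} {P P' : Set DescartesConfiguration}
    (h : motionCircles φ '' geometricConfigurations P = geometricConfigurations P') :
    motionCircles φ (geometricCircles P) = geometricCircles P' := by
  rw [geometricCircles_eq_sUnion, geometricCircles_eq_sUnion, ← h, motionCircles,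
    Set.image_sUnion]
  rfl

theorem image_geometricPointSet {φ : ℂ ≃ᵢ ℂ} {P P' : Set DescartesConfiguration}
    (h : motionCircles φ '' geometricConfigurations P = geometricConfigurations P') :
    motion φ '' geometricPointSet P = geometricPointSet P' := by
  rw [geometricPointSet_eq_sUnion, geometricPointSet_eq_sUnion, ← image_geometricCircles h,
    Set.image_sUnion]
  rfl

/-- The Euclidean motion `z ↦ α z + c`. -/
noncomputable def rigidMotion (α : ℂ ≃ₗᵢ[ℝ] ℂ) (c : ℂ) : ℂ ≃ᵢ ℂ :=
  α.toIsometryEquiv.trans (IsometryEquiv.addRight c)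

theorem rigidMotion_apply (α : ℂ ≃ₗᵢ[ℝ] ℂ) (c z : ℂ) : rigidMotion α c z = α z + c := rfl

/-- The action of `rigidMotion α c` on augmented curvature-center coordinates. -/
noncomputable def motionCoords (α : ℂ ≃ₗᵢ[ℝ] ℂ) (c : ℂ) : (Fin 4 → ℝ) →ₗ[ℝ] (Fin 4 → ℝ) where
  toFun v := ![v 0 + 2 * ((α ⟨v 2, v 3⟩).re * c.re + (α ⟨v 2, v 3⟩).im * c.im) +
    v 1 * (c.re ^ 2 + c.im ^ 2), v 1, (α ⟨v 2, v 3⟩).re + v 1 * c.re,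
    (α ⟨v 2, v 3⟩).im + v 1 * c.im]
  map_add' v w := by
    have h : (⟨(v + w) 2, (v + w) 3⟩ : ℂ) = ⟨v 2, v 3⟩ + ⟨w 2, w 3⟩ := by
      apply Complex.ext <;> simp
    rw [h, map_add]
    ext i
    fin_cases i <;> simp <;> ring
  map_smul' r v := by
    have h : (⟨(r • v) 2, (r • v) 3⟩ : ℂ) = r • (⟨v 2, v 3⟩ : ℂ) := by
      apply Complex.ext <;> simp
    rw [h, map_smul]
    ext i
    fin_cases i <;> simp <;> ring

theorem motionCoords_apply (α : ℂ ≃ₗᵢ[ℝ] ℂ) (c : ℂ) (v : Fin 4 → ℝ) :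
    motionCoords α c v =
      ![v 0 + 2 * ((α ⟨v 2, v 3⟩).re * c.re + (α ⟨v 2, v 3⟩).im * c.im) +
        v 1 * (c.re ^ 2 + c.im ^ 2), v 1, (α ⟨v 2, v 3⟩).re + v 1 * c.re,
        (α ⟨v 2, v 3⟩).im + v 1 * c.im] := rfl

theorem motionCoords_one (α : ℂ ≃ₗᵢ[ℝ] ℂ) (c : ℂ) (v : Fin 4 → ℝ) :
    motionCoords α c v 1 = v 1 := rfl

/-- This invariance is what justifies the formula for `motionCoords`, because circles are zero sets
of `power`. -/
theorem power_motionCoords (α : ℂ ≃ₗᵢ[ℝ] ℂ) (c : ℂ) (v : Fin 4 → ℝ) (z : ℂ) :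
    power (motionCoords α c v) (rigidMotion α c z) = power v z := by
  have h1 : (α z).re ^ 2 + (α z).im ^ 2 = z.re ^ 2 + z.im ^ 2 := by
    rw [← OrientedCircle.norm_sq_eq, ← OrientedCircle.norm_sq_eq, α.norm_map]
  have h2 : (α ⟨v 2, v 3⟩).re * (α z).re + (α ⟨v 2, v 3⟩).im * (α z).im =
      v 2 * z.re + v 3 * z.im := by
    have := α.inner_map_map ⟨v 2, v 3⟩ z
    simp only [Complex.inner, Complex.mul_re, Complex.conj_re, Complex.conj_im] at this
    linarith
  rw [motionCoords_apply, rigidMotion_apply]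
  simp only [power]
  simp
  linear_combination v 1 * h1 - 2 * h2

/-- The scalar `ε` does not change the zero set; it is there to absorb a reversal of orientation. -/
theorem motion_image_points (α : ℂ ≃ₗᵢ[ℝ] ℂ) (c : ℂ) {C C' : OrientedCircle} {ε : ℝ}
    (hε : ε ≠ 0) (h : C'.coords = ε • motionCoords α c C.coords) :
    motion (rigidMotion α c) '' C.points = C'.points := by
  have key : motion (rigidMotion α c) ⁻¹' C'.points = C.points := by
    ext p
    induction p using OnePoint.rec with
    | infty =>
      change OnePoint.infty ∈ C'.points ↔ _
      rw [OrientedCircle.infty_mem_points, OrientedCircle.infty_mem_points, h, Pi.smul_apply,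
        motionCoords_one, smul_eq_mul, mul_eq_zero, or_iff_right hε]
    | coe z =>
      change ((rigidMotion α c z : ℂ) : RiemannSphere) ∈ C'.points ↔ _
      have hs : ∀ (v : Fin 4 → ℝ) (z : ℂ), power (ε • v) z = ε * power v z := by
        intro v z
        simp only [power, Pi.smul_apply, smul_eq_mul]; ring
      rw [OrientedCircle.coe_mem_points, OrientedCircle.coe_mem_points, h, hs,
        power_motionCoords, mul_eq_zero, or_iff_right hε]
  rw [← key, Set.image_preimage_eq _ (motion_surjective _)]

/-- The matrix whose rows are the images of the rows of `W`. -/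
def mapRows (f : (Fin 4 → ℝ) →ₗ[ℝ] (Fin 4 → ℝ)) (W : Matrix (Fin 4) (Fin 4) ℝ) :
    Matrix (Fin 4) (Fin 4) ℝ :=
  Matrix.of fun i => f (W i)

/-- Left multiplication forms linear combinations of rows, so it commutes with any linear map
applied to each row; hence motions commute with the group. -/
theorem mul_mapRows (f : (Fin 4 → ℝ) →ₗ[ℝ] (Fin 4 → ℝ)) (A W : Matrix (Fin 4) (Fin 4) ℝ) :
    A * mapRows f W = mapRows f (A * W) := by
  ext i j
  have h : (A * W) i = ∑ k, A i k • W k := by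
    ext l
    simp [Matrix.mul_apply]
  simp only [mapRows, Matrix.of_apply]
  rw [h, map_sum, Matrix.mul_apply, Finset.sum_apply]
  simp

theorem motionCircles_unordered (α : ℂ ≃ₗᵢ[ℝ] ℂ) (c : ℂ) {D D' : DescartesConfiguration} {ε : ℝ}
    (hε : ε ≠ 0) (σ : Equiv.Perm (Fin 4))
    (h : D'.W = ε • (mapRows (motionCoords α c) D.W).submatrix σ id) :
    motionCircles (rigidMotion α c) D.unordered = D'.unordered := by
  have h' : ∀ i, motion (rigidMotion α c) '' (D.circles (σ i)).points = (D'.circles i).points :=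
    fun i => motion_image_points α c hε (congrFun h i)
  simp only [motionCircles, DescartesConfiguration.unordered, ← h']
  rw [← Set.range_comp]
  exact (σ.surjective.range_comp
    fun i => motion (rigidMotion α c) '' (D.circles i).points).symm

theorem image_geometricConfigurations (α : ℂ ≃ₗᵢ[ℝ] ℂ) (c : ℂ) {D D' : DescartesConfiguration}
    {ε : ℝ} (hε : ε ≠ 0) (σ : Equiv.Perm (Fin 4))
    (h : D'.W = ε • (mapRows (motionCoords α c) D.W).submatrix σ id) :
    motionCircles (rigidMotion α c) '' geometricConfigurations (superOrbit D) =
      geometricConfigurations (superOrbit D') := by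
  -- The congruence between the base configurations passes to all of the orbit, with `U` on one side
  -- matched to its conjugate on the other.
  have key : ∀ U, realMatrix (permConj σ U) * D'.W =
      ε • (mapRows (motionCoords α c) (realMatrix U * D.W)).submatrix σ id := by
    intro U
    rw [h, Matrix.mul_smul, permConj_mul_submatrix, mul_mapRows]
  ext K
  constructor
  · rintro ⟨_, ⟨E, ⟨U, hU, hE⟩, rfl⟩, rfl⟩
    obtain ⟨E', hE', hW⟩ := exists_mem_superOrbit D' (permConj_mem σ hU)
    refine ⟨E', hE', motionCircles_unordered α c hε σ ?_⟩
    rw [hW, key, hE]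
    rfl
  · rintro ⟨E', ⟨U, hU, hE'⟩, rfl⟩
    obtain ⟨E, hE, hW⟩ := exists_mem_superOrbit D (permConj_mem σ.symm hU)
    refine ⟨E.unordered, ⟨E, hE, rfl⟩, motionCircles_unordered α c hε σ ?_⟩
    have hUU : permConj σ (permConj σ.symm U) = U := by
      apply Units.ext
      rw [permConj_apply, permConj_apply]
      simp
    rw [hW, ← key, hUU]
    exact hE'

/-! ### Congruence with the strip -/

/-- Coordinates of the configuration of two horizontal lines and two circles of curvature `g`. -/
noncomputable def stripCoords (g : ℝ) : Matrix (Fin 4) (Fin 4) ℝ :=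
  !![2 / g, 0, 0, 1; 2 / g, 0, 0, -1; 0, g, 1, 0; 0, g, -1, 0]

theorem stripCoords_isDescartesFrame {g : ℝ} (hg : g ≠ 0) : IsDescartesFrame (stripCoords g) := by
  intro i j
  fin_cases i <;> fin_cases j <;> simp [pairing, stripCoords, hg, mul_div_cancel₀ _ hg]

theorem exists_linearIsometryEquiv {x y : ℝ} (h : x ^ 2 + y ^ 2 = 1) {s : ℝ}
    (hs : s = 1 ∨ s = -1) : ∃ α : ℂ ≃ₗᵢ[ℝ] ℂ, ∀ z : ℂ,
      (α z).re = x * z.re - s * y * z.im ∧ (α z).im = y * z.re + s * x * z.im := by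
  obtain ⟨k, hk⟩ : ∃ k : Circle, (k : ℂ) = ⟨x, y⟩ := by
    refine ⟨⟨⟨x, y⟩, mem_sphere_zero_iff_norm.mpr ?_⟩, rfl⟩
    rw [← sq_eq_sq₀ (norm_nonneg _) zero_le_one,
      OrientedCircle.norm_sq_eq]
    simpa using h
  rcases hs with rfl | rfl
  · refine ⟨rotation k, fun z => ?_⟩
    rw [rotation_apply, hk]
    simp [Complex.mul_re, Complex.mul_im]
    ring
  · refine ⟨Complex.conjLIE.trans (rotation k), fun z => ?_⟩
    rw [LinearIsometryEquiv.trans_apply, rotation_apply, hk]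
    simp [Complex.mul_re, Complex.mul_im]
    ring

/-- All Descartes configurations with curvatures `(0, 0, g, g)` are congruent. -/
theorem IsDescartesFrame.exists_motionCoords {v : Matrix (Fin 4) (Fin 4) ℝ}
    (hv : IsDescartesFrame v) {g : ℝ} (hg : g ≠ 0) (h : ∀ i, v i 1 = ![0, 0, g, g] i) :
    ∃ (α : ℂ ≃ₗᵢ[ℝ] ℂ) (c : ℂ), v = mapRows (motionCoords α c) (stripCoords g) := by
  have b0 : v 0 1 = 0 := h 0
  have b1 : v 1 1 = 0 := h 1
  have b2 : v 2 1 = g := h 2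
  have b3 : v 3 1 = g := h 3
  have p00 := hv 0 0
  have p11 := hv 1 1
  have p22 := hv 2 2
  have p33 := hv 3 3
  have p01 := hv 0 1
  have p02 := hv 0 2
  have p03 := hv 0 3
  have p12 := hv 1 2
  have p23 := hv 2 3
  simp [pairing, b0, b1, b2, b3] at p00 p11 p22 p33 p01 p02 p03 p12 p23
  obtain ⟨e1, e2⟩ := add_sq_eq_zero (a := v 0 2 + v 1 2) (b := v 0 3 + v 1 3)
    (by linear_combination p00 + p11 + 2 * p01)
  -- (x, y) is the unit vector along the line of centers of the two circles, the image of the real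
  -- direction of the strip.
  set x := (v 2 2 - v 3 2) / 2 with hx
  set y := (v 2 3 - v 3 3) / 2 with hy
  have hxy : x ^ 2 + y ^ 2 = 1 := by
    rw [hx, hy]; linear_combination (p22 + p33 - 2 * p23) / 4
  have hperp : v 0 2 * x + v 0 3 * y = 0 := by
    rw [hx, hy]; linear_combination (p02 - p03) / 2
  -- The lines have normals perpendicular to (x, y); `s` records on which side, hence whether a
  -- reflection is needed.
  obtain ⟨s, hs, hs'⟩ : ∃ s : ℝ, (s = 1 ∨ s = -1) ∧ s = v 0 3 * x - v 0 2 * y := by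
    refine ⟨_, ?_, rfl⟩
    rw [← mul_self_eq_one_iff]
    linear_combination p00 + (v 0 2 ^ 2 + v 0 3 ^ 2) * hxy - (v 0 2 * x + v 0 3 * y) * hperp
  have hss : s ^ 2 = 1 := by rcases hs with rfl | rfl <;> norm_num
  obtain ⟨f1, f2⟩ := add_sq_eq_zero (a := v 0 2 + s * y) (b := v 0 3 - s * x)
    (by linear_combination p00 + s ^ 2 * hxy + 2 * s * hs' - hss)
  obtain ⟨α, hα⟩ := exists_linearIsometryEquiv hxy hs
  -- The translation is the midpoint of the two centers, since the strip's centers are symmetric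
  -- about 0.
  set cx := (v 2 2 + v 3 2) / (2 * g) with hcx
  set cy := (v 2 3 + v 3 3) / (2 * g) with hcy
  have r02 : v 0 2 = -(s * y) := by linarith
  have r03 : v 0 3 = s * x := by linarith
  have r12 : v 1 2 = s * y := by linarith
  have r13 : v 1 3 = -(s * x) := by linarith
  have r22 : v 2 2 = x + g * cx := by rw [hx, hcx]; field_simp; ring
  have r23 : v 2 3 = y + g * cy := by rw [hy, hcy]; field_simp; ring
  have r32 : v 3 2 = -x + g * cx := by rw [hx, hcx]; field_simp; ring
  have r33 : v 3 3 = -y + g * cy := by rw [hy, hcy]; field_simp; ring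
  have r00 : v 0 0 = 2 / g + 2 * (-(s * y) * cx + s * x * cy) := by
    rw [r02, r03, r22, r23] at p02
    field_simp
    linear_combination -2 * p02
  have r10 : v 1 0 = 2 / g + 2 * (s * y * cx + -(s * x) * cy) := by
    rw [r12, r13, r22, r23] at p12
    field_simp
    linear_combination -2 * p12
  have r20 : v 2 0 = 2 * (x * cx + y * cy) + g * (cx ^ 2 + cy ^ 2) := by
    rw [r22, r23] at p22
    apply mul_left_cancel₀ hg
    linear_combination -p22 + hxy
  have r30 : v 3 0 = 2 * (-x * cx + -y * cy) + g * (cx ^ 2 + cy ^ 2) := by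
    rw [r32, r33] at p33
    apply mul_left_cancel₀ hg
    linear_combination -p33 + hxy
  refine ⟨α, ⟨cx, cy⟩, ?_⟩
  clear_value cx cy x y
  ext i j
  simp only [mapRows, motionCoords_apply, Matrix.of_apply, hα, stripCoords]
  fin_cases i <;> fin_cases j <;>
    simp [b0, b1, b2, b3, r00, r10, r20, r30, r02, r03, r12, r13, r22, r23, r32, r33]

/-- Every integral super-packing with divisor `g` is congruent to that of the strip. -/
theorem exists_image_strip_eq {g : ℕ} (hg : 1 ≤ g) {D₀ D : DescartesConfiguration}
    (hD₀ : D₀.W = stripCoords g) (hD : D.HasDivisor g) :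
    ∃ φ : ℂ ≃ᵢ ℂ, motionCircles φ '' geometricConfigurations (superOrbit D₀) =
      geometricConfigurations (superOrbit D) := by
  obtain ⟨b, hb, hgcd⟩ := hD
  have hrel := descartes_relation hb
  have hne : ∑ i, b i ≠ 0 := by
    intro h0
    rw [h0] at hrel
    have hz : ∀ i, b i = 0 := by
      intro i
      have : ∑ i, b i ^ 2 = 0 := by linarith
      have := (Finset.sum_eq_zero_iff_of_nonneg fun i _ => sq_nonneg (b i)).mp this i
        (Finset.mem_univ i)
      exact pow_eq_zero_iff two_ne_zero |>.mp this
    have : Finset.univ.gcd b = 0 := Finset.gcd_eq_zero_iff.mpr fun i _ => hz i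
    omega
  -- `ε` reverses all orientations if necessary, because the descent needs a positive sum.
  obtain ⟨ε, hε, hpos⟩ : ∃ ε : ℤ, ε * ε = 1 ∧ 0 < ∑ i, ε * b i := by
    rcases lt_or_gt_of_ne hne with h | h
    · exact ⟨-1, by norm_num, by rw [← Finset.mul_sum]; linarith⟩
    · exact ⟨1, by norm_num, by rw [← Finset.mul_sum]; linarith⟩
  obtain ⟨U, hU, σ, m, hm, he⟩ := exists_reduction (∑ i, ε * b i).toNat (fun i => ε * b i)
    (by
      simp only [mul_pow, ← Finset.mul_sum]
      linear_combination ε ^ 2 * hrel) hpos (by omega)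
  have he' : ∀ i, U.val.mulVec b (σ i) = ε * ![0, 0, m, m] i := by
    intro i
    rw [← congrFun he i, Function.comp_apply, show (fun i => ε * b i) = ε • b from rfl,
      Matrix.mulVec_smul, Pi.smul_apply, smul_eq_mul, ← mul_assoc, hε, one_mul]
  have hmg : m = g := by
    have hgU := gcd_mulVec U b
    rw [hgcd] at hgU
    have h1 : m ∣ g := by
      rw [← hgU]
      refine Finset.dvd_gcd fun j _ => ?_
      obtain ⟨i, rfl⟩ := σ.surjective j
      rw [he' i]
      fin_cases i <;> simp
    have h2 : (g : ℤ) ∣ m := by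
      have : (g : ℤ) ∣ U.val.mulVec b (σ 2) := hgU ▸ Finset.gcd_dvd (Finset.mem_univ _)
      rw [he' 2] at this
      have := this.mul_left ε
      rw [← mul_assoc, hε, one_mul] at this
      exact this
    exact Int.dvd_antisymm hm.le (by positivity) h1 h2
  obtain ⟨D', hD', hW⟩ := exists_mem_superOrbit D hU
  have hεR : (ε : ℝ) * ε = 1 := by exact_mod_cast hε
  have hε0 : (ε : ℝ) ≠ 0 := left_ne_zero_of_mul_eq_one hεR
  have hg0 : (g : ℝ) ≠ 0 := by positivity
  -- Reordered and reoriented, the reduced configuration has curvatures (0,0,g,g) and is still a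
  -- frame, since ε² = 1.
  set v : Matrix (Fin 4) (Fin 4) ℝ := (ε : ℝ) • D'.W.submatrix σ id with hv
  have hframe : IsDescartesFrame v := by
    intro i j
    have h1 : pairing (v i) (v j) = (ε * ε : ℝ) * pairing (D'.W (σ i)) (D'.W (σ j)) := by
      simp [hv, pairing]; ring
    rw [h1, hεR, one_mul, D'.isDescartesFrame]
    simp
  have hcurv : ∀ i, v i 1 = ![0, 0, (g : ℝ), (g : ℝ)] i := by
    intro i
    have h1 : v i 1 = ε * (D'.circles (σ i)).curvature := by
      rw [OrientedCircle.curvature_eq]; rfl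
    rw [h1, curvature_mulVec hW hb, he', Int.cast_mul, ← mul_assoc, hεR, one_mul, hmg]
    fin_cases i <;> simp
  obtain ⟨α, c, hα⟩ := hframe.exists_motionCoords hg0 hcurv
  refine ⟨rigidMotion α c, ?_⟩
  rw [superOrbit_eq hD']
  refine image_geometricConfigurations α c hε0 σ.symm ?_
  rw [hD₀, ← hα, hv]
  ext i j
  simp [← mul_assoc, hεR]

theorem exists_strip {g : ℕ} (hg : 1 ≤ g) :
    ∃ D : DescartesConfiguration, D.W = stripCoords g ∧ D.HasDivisor g := by
  have hg0 : (g : ℝ) ≠ 0 := by positivity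
  obtain ⟨D, hD⟩ := (stripCoords_isDescartesFrame hg0).exists_configuration
  refine ⟨D, hD, ![0, 0, g, g], fun i => ?_, ?_⟩
  · rw [OrientedCircle.curvature_eq]
    change D.W i 1 = _
    rw [hD]
    fin_cases i <;> simp [stripCoords]
  · refine Int.dvd_antisymm ?_ (by positivity) ?_ ?_
    · rw [← Finset.normalize_gcd]
      exact Int.nonneg_of_normalize_eq_self (normalize_idem _)
    · exact Finset.gcd_dvd (f := ![0, 0, (g : ℤ), (g : ℤ)]) (Finset.mem_univ 2)
    · refine Finset.dvd_gcd fun i _ => ?_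
      fin_cases i <;> simp

theorem exists_motion_of_hasDivisor {g : ℕ} (hg : 1 ≤ g) {D D' : DescartesConfiguration}
    (hD : D.HasDivisor g) (hD' : D'.HasDivisor g) :
    ∃ φ : ℂ ≃ᵢ ℂ, motionCircles φ '' geometricConfigurations (superOrbit D) =
      geometricConfigurations (superOrbit D') := by
  obtain ⟨D₀, hD₀, -⟩ := exists_strip hg
  obtain ⟨φ, hφ⟩ := exists_image_strip_eq hg hD₀ hD
  obtain ⟨ψ, hψ⟩ := exists_image_strip_eq hg hD₀ hD'
  refine ⟨φ.symm.trans ψ, ?_⟩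
  rw [← hφ, ← hψ, motionCircles_trans, Set.image_comp, ← Set.image_comp (motionCircles φ.symm),
    ← motionCircles_trans, show φ.trans φ.symm = IsometryEquiv.refl ℂ from
    IsometryEquiv.ext fun z => φ.symm_apply_apply z, motionCircles_refl, Set.image_id]

end Apollonian

theorem theorem4p1 (g : ℕ) (hg : 1 ≤ g) :
    -- integrality and the divisor of a super-packing can be read off any of its configurations
    (∀ P : Set Apollonian.DescartesConfiguration, Apollonian.IsSuperPacking P →
      (∃ D ∈ P, D.HasDivisor g) → Apollonian.PackingHasDivisor P g) ∧
    -- existence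
    (∃ P : Set Apollonian.DescartesConfiguration, Apollonian.IsSuperPacking P ∧
      Apollonian.IsIntegralPacking P ∧ Apollonian.PackingHasDivisor P g) ∧
    -- uniqueness of the geometric super-packing up to a Euclidean motion
    (∀ P P' : Set Apollonian.DescartesConfiguration,
      Apollonian.IsSuperPacking P → Apollonian.IsIntegralPacking P →
      Apollonian.PackingHasDivisor P g →
      Apollonian.IsSuperPacking P' → Apollonian.IsIntegralPacking P' →
      Apollonian.PackingHasDivisor P' g →
      ∃ φ : ℂ ≃ᵢ ℂ,
        Apollonian.motion φ '' Apollonian.geometricPointSet P =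
          Apollonian.geometricPointSet P' ∧
        Apollonian.motionCircles φ (Apollonian.geometricCircles P) =
          Apollonian.geometricCircles P' ∧
        Apollonian.motionCircles φ '' Apollonian.geometricConfigurations P =
          Apollonian.geometricConfigurations P') ∧
    -- it contains a copy of every integral Descartes configuration with divisor `g`
    (∀ P : Set Apollonian.DescartesConfiguration,
      Apollonian.IsSuperPacking P → Apollonian.IsIntegralPacking P →
      Apollonian.PackingHasDivisor P g →
      ∀ D : Apollonian.DescartesConfiguration, D.HasDivisor g →
        ∃ φ : ℂ ≃ᵢ ℂ,
          Apollonian.motionCircles φ D.unordered ∈ Apollonian.geometricConfigurations P) := by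
  open Apollonian in
  refine ⟨?_, ?_, ?_, ?_⟩
  · rintro _ ⟨D₀, rfl⟩ ⟨D, hD, hg⟩ D' hD'
    exact hg.of_mem_superOrbit (superOrbit_trans (superOrbit_symm hD) hD')
  · obtain ⟨D, -, hD⟩ := exists_strip hg
    refine ⟨superOrbit D, ⟨D, rfl⟩, ⟨D, self_mem_superOrbit D, ?_⟩,
      fun D' hD' => hD.of_mem_superOrbit hD'⟩
    obtain ⟨b, hb, -⟩ := hD
    exact fun i => ⟨b i, hb i⟩
  · rintro _ _ ⟨D, rfl⟩ - hD ⟨D', rfl⟩ - hD'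
    obtain ⟨φ, hφ⟩ := exists_motion_of_hasDivisor hg (hD D (self_mem_superOrbit D))
      (hD' D' (self_mem_superOrbit D'))
    exact ⟨φ, image_geometricPointSet hφ, image_geometricCircles hφ, hφ⟩
  · rintro _ ⟨D', rfl⟩ - hD' D hD
    -- Uniqueness is applied to the orbit of `D` itself; the image of `D` is the required copy.
    obtain ⟨φ, hφ⟩ := exists_motion_of_hasDivisor hg hD (hD' D' (self_mem_superOrbit D'))
    exact ⟨φ, hφ ▸ Set.mem_image_of_mem _ ⟨D, self_mem_superOrbit D, rfl⟩⟩
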